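/- For real $x$ and an integer $j\ge 0$ let $(x)_j=x(x+1)\cdots(x+j-1)$, with $(x)_0=1$, and write $$\left[\begin{matrix}a_1,a_2,a_3\\ b_1,b_2,b_3\end{matrix}\right]_j=\frac{(a_1)_j(a_2)_j(a_3)_j}{(b_1)_j(b_2)_j(b_3)_j}.$$ A formula $$S=\sum_{j=0}^{\infty} z^j\left[\begin{matrix}a_1,a_2,a_3\\ b_1,b_2,b_3\end{matrix}\right]_j(c_1 j+c_2)$$ with rational $a_i,b_i,c_i,z$ is called here *of Ramanujan type with convergence rate $z$* if no $(b_k)_j$ vanishes, no difference $a_i-b_k$ is an integer, the ratio of consecutive summands tends to $z$, and the series converges absolutely with sum $S$. The following eleven formulas hold, and each of them is of Ramanujan type with convergence rate $-\frac14$: \begin{align*} 8\sqrt2 &= \sum_{j=0}^{\infty}\left(-\tfrac14\right)^j\left[\begin{matrix}\frac58,\frac34,\frac98\\ \frac12,1,\frac32\end{matrix}\right]_j(40j+19),\\ 16\sqrt2 &= \sum_{j=0}^{\infty}\left(-\tfrac14\right)^j\left[\begin{matrix}\frac18,\frac58,\frac34\\ 1,\frac32,\frac32\end{matrix}\right]_j(40j+23),\\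 \frac{8\sqrt2}{5} &= \sum_{j=0}^{\infty}\left(-\tfrac14\right)^j\left[\begin{matrix}\frac58,\frac34,\frac98\\ 1,\frac54,\frac54\end{matrix}\right]_j(8j+3),\\ \frac{96\sqrt2}{7} &= \sum_{j=0}^{\infty}\left(-\tfrac14\right)^j\left[\begin{matrix}\frac54,\frac{11}8,\frac{15}8\\ 1,\frac74,\frac74\end{matrix}\right]_j(40j+33),\\ \frac{416\sqrt2}{81} &= \sum_{j=0}^{\infty}\left(-\tfrac14\right)^j\left[\begin{matrix}\frac78,\frac54,\frac{11}8\\ 1,\frac{17}{12},\frac{25}{12}\end{matrix}\right]_j(8j+9),\\ \frac{56\sqrt2}{3} &= \sum_{j=0}^{\infty}\left(-\tfrac14\right)^j\left[\begin{matrix}\frac18,\frac58,\frac34\\ \frac{11}{12},1,\frac{19}{12}\end{matrix}\right]_j(40j+27),\\ \frac{256\sqrt3}{9} &= \sum_{j=0}^{\infty}\left(-\tfrac14\right)^j\left[\begin{matrix}-\frac1{12},\frac5{12},\frac56\\ 1,\frac53,\frac53\end{matrix}\right]_j(60j+49),\\ -\frac{\sqrt3}{2} &= \sum_{j=0}^{\infty}\left(-\tfrac14\right)^j\left[\begin{matrix}\frac1{12},\frac16,\frac7{12}\\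 -\frac23,\frac13,1\end{matrix}\right]_j(60j-1),\\ 16\log 2 &= \sum_{j=0}^{\infty}\left(-\tfrac14\right)^j\left[\begin{matrix}\frac34,1,\frac54\\ \frac32,\frac32,\frac32\end{matrix}\right]_j(20j+13),\\ \frac{44\sqrt[3]2}{9} &= \sum_{j=0}^{\infty}\left(-\tfrac14\right)^j\left[\begin{matrix}\frac23,\frac34,\frac54\\ \frac5{12},1,\frac{23}{12}\end{matrix}\right]_j(10j+9),\\ \frac{20\sqrt[3]2}{3} &= \sum_{j=0}^{\infty}\left(-\tfrac14\right)^j\left[\begin{matrix}\frac14,\frac23,\frac34\\ \frac{11}{12},1,\frac{17}{12}\end{matrix}\right]_j(20j+9). \end{align*} -/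

import Mathlib

open Filter Topology

noncomputable section

/-- The rising factorial (Pochhammer symbol) `(x)_n = x (x + 1) ⋯ (x + n - 1)`, with `(x)_0 = 1`. -/
def poch (x : ℝ) (n : ℕ) : ℝ := ∏ i ∈ Finset.range n, (x + i)

/-- The quotient of rising factorials
`[a₁, a₂, a₃; b₁, b₂, b₃]_n = (a₁)_n (a₂)_n (a₃)_n / ((b₁)_n (b₂)_n (b₃)_n)`. -/
def pochQuot (a b : Fin 3 → ℚ) (n : ℕ) : ℝ :=
  (∏ i, poch (a i : ℝ) n) / ∏ i, poch (b i : ℝ) n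

/-- The summand `z^n [a₁, a₂, a₃; b₁, b₂, b₃]_n (c₁ n + c₂)`. -/
def ramanujanTerm (z : ℚ) (a b : Fin 3 → ℚ) (c₁ c₂ : ℚ) (n : ℕ) : ℝ :=
  (z : ℝ) ^ n * pochQuot a b n * ((c₁ : ℝ) * n + c₂)

/-- `S = ∑_{n ≥ 0} z^n [a₁, a₂, a₃; b₁, b₂, b₃]_n (c₁ n + c₂)` is a formula of Ramanujan type
with convergence rate `z`, all parameters being rational. -/
structure IsRamanujanTypeFormula (S : ℝ) (z : ℚ) (a b : Fin 3 → ℚ) (c₁ c₂ : ℚ) : Prop where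
  /-- No denominator `(b_k)_n` vanishes. -/
  denom_ne_zero : ∀ (k : Fin 3) (n : ℕ), poch (b k : ℝ) n ≠ 0
  /-- An upper and a lower argument never differ by an integer. -/
  irreducible : ∀ (i k : Fin 3) (m : ℤ), a i - b k ≠ m
  /-- Quotients of consecutive summands tend to the convergence rate. -/
  rate : Tendsto (fun n : ℕ => ramanujanTerm z a b c₁ c₂ (n + 1) / ramanujanTerm z a b c₁ c₂ n)
    atTop (𝓝 (z : ℝ))
  /-- The series converges (absolutely) with sum `S`. -/
  hasSum : HasSum (fun n : ℕ => ramanujanTerm z a b c₁ c₂ n) S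

end

/-! Every formula comes from one Wilf–Zeilberger acceleration of `∑ (a)_m (b)_m / ((c)_m (d)_m)`.
Put `F(n,m) = accelCoeff n * hypTerm a (b+n) (c+n) (d+2n) m`. A rational certificate gives `G = F *
accelCert` with `F(n,m) - F(n+1,m) = G(n,m) - G(n,m+1)`. Summing over `m` leaves only `G(n,0)`, and
the row sums of `F` tend to `0`, so summing over `n` shows that the original series equals `∑
G(n,0)`, whose coefficient ratio tends to `-1/4` (`tendsto_sum_accel`).

The ratio of the coefficients of `∑ G(n,0)` has five factors over five. For the parameters chosen
here two pairs cancel up to integer shifts; a rational function `R n` absorbs the remaining shifts,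
and `R n * accelFactor n` is linear in `n`, except in the formula for `-√3/2`, where a telescoping
correction is needed.

When `c` or `d` is `1` the original series is Gauss's (`tsum_hypTerm_one`), and the Gamma values
reduce by reflection or duplication. For `log 2` it is the alternating harmonic series up to a
factor. -/

/-! ### Rising factorials -/

theorem poch_zero (x : ℝ) : poch x 0 = 1 := by simp [poch]

theorem poch_succ (x : ℝ) (n : ℕ) : poch x (n + 1) = poch x n * (x + n) :=
  Finset.prod_range_succ _ _

theorem poch_add_one_mul (x : ℝ) (n : ℕ) : poch (x + 1) n * x = poch x n * (x + n) := by
  rw [← poch_succ, poch, poch, Finset.prod_range_succ']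
  congr 1
  · exact Finset.prod_congr rfl fun i _ => by push_cast; ring
  · simp

theorem poch_ne_zero {x : ℝ} (hx : ∀ k : ℕ, x ≠ -k) (n : ℕ) : poch x n ≠ 0 :=
  Finset.prod_ne_zero_iff.2 fun i _ h => hx i (by linarith)

theorem poch_pos {x : ℝ} (hx : 0 < x) (n : ℕ) : 0 < poch x n :=
  Finset.prod_pos fun i _ => by positivity

theorem poch_mono {x y : ℝ} (hx : 0 < x) (h : x ≤ y) (n : ℕ) : poch x n ≤ poch y n :=
  Finset.prod_le_prod (fun i _ => by positivity) fun i _ => by linarith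

theorem ne_neg_natCast_of_pos {x : ℝ} (hx : 0 < x) (k : ℕ) : x ≠ -k := by
  have : (0 : ℝ) ≤ k := k.cast_nonneg
  intro h
  linarith

theorem ne_neg_natCast_add {x : ℝ} (hx : ∀ k : ℕ, x ≠ -k) (n : ℕ) (k : ℕ) : x + n ≠ -k := by
  intro h
  refine hx (n + k) ?_
  push_cast
  linarith

/-- Ratio asymptotics of rising factorials. -/
theorem tendsto_poch_div_poch {x : ℝ} (hx : ∀ k : ℕ, x ≠ -k) (y : ℝ) :
    Tendsto (fun n : ℕ => poch x (n + 1) / poch y (n + 1) * (n : ℝ) ^ (y - x)) atTop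
      (𝓝 (Real.Gamma y / Real.Gamma x)) := by
  -- The product in `GammaSeq x n` has `n + 1` factors, so it is `poch x (n + 1)`; this is why the
  -- index is shifted.
  refine ((Real.GammaSeq_tendsto_Gamma y).div (Real.GammaSeq_tendsto_Gamma x)
    (Real.Gamma_ne_zero hx)).congr' ?_
  filter_upwards [eventually_gt_atTop 0] with n hn
  have hn' : (0 : ℝ) < n := by exact_mod_cast hn
  have h1 := poch_ne_zero hx (n + 1)
  have h2 : (n.factorial : ℝ) ≠ 0 := by positivity
  have h3 : (n : ℝ) ^ x ≠ 0 := by positivity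
  simp only [Pi.div_apply, Real.GammaSeq, Real.rpow_sub hn']
  change (n : ℝ) ^ y * n.factorial / poch y (n + 1) / ((n : ℝ) ^ x * n.factorial / poch x (n + 1))
    = _
  field_simp

/-! ### Hypergeometric series at argument 1 and Gauss's theorem -/

/-- The summand `(a)_m (b)_m / ((c)_m (d)_m)` of a hypergeometric series at argument `1`. -/
noncomputable def hypTerm (a b c d : ℝ) (m : ℕ) : ℝ :=
  poch a m * poch b m / (poch c m * poch d m)

theorem hypTerm_zero (a b c d : ℝ) : hypTerm a b c d 0 = 1 := by simp [hypTerm, poch_zero]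

theorem hypTerm_succ (a b c d : ℝ) (m : ℕ) :
    hypTerm a b c d (m + 1) = hypTerm a b c d m * ((a + m) * (b + m) / ((c + m) * (d + m))) := by
  simp only [hypTerm, poch_succ, div_mul_div_comm]
  congr 1 <;> ring

theorem tendsto_hypTerm_mul_rpow {a b : ℝ} (ha : ∀ k : ℕ, a ≠ -k) (hb : ∀ k : ℕ, b ≠ -k)
    (c d : ℝ) :
    Tendsto (fun m : ℕ => hypTerm a b c d (m + 1) * (m : ℝ) ^ (c + d - a - b)) atTop
      (𝓝 (Real.Gamma c * Real.Gamma d / (Real.Gamma a * Real.Gamma b))) := by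
  have h := (tendsto_poch_div_poch ha c).mul (tendsto_poch_div_poch hb d)
  rw [div_mul_div_comm] at h
  refine h.congr' ?_
  filter_upwards [eventually_gt_atTop 0] with n hn
  have hn' : (0 : ℝ) < n := by exact_mod_cast hn
  rw [show c + d - a - b = (c - a) + (d - b) by ring, Real.rpow_add hn', hypTerm,
    ← div_mul_div_comm]
  ring

/-- By the Gamma asymptotics the terms are `O(m ^ (-(c + d - a - b)))`. -/
theorem summable_hypTerm {a b c d : ℝ} (ha : ∀ k : ℕ, a ≠ -k) (hb : ∀ k : ℕ, b ≠ -k)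
    (h : 1 < c + d - a - b) : Summable (hypTerm a b c d) := by
  rw [← summable_nat_add_iff 1]
  refine summable_of_isBigO_nat (Real.summable_nat_rpow.2 (neg_lt_neg h)) ?_
  refine Asymptotics.IsBigO.congr' ((tendsto_hypTerm_mul_rpow ha hb c d).isBigO_one ℝ |>.mul
    (Asymptotics.isBigO_refl (fun m : ℕ => (m : ℝ) ^ (-(c + d - a - b))) atTop)) ?_ ?_
  · filter_upwards [eventually_gt_atTop 0] with n hn
    have hn' : (0 : ℝ) < n := by exact_mod_cast hn
    rw [mul_assoc, ← Real.rpow_add hn', add_neg_cancel, Real.rpow_zero, mul_one]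
  · exact Eventually.of_forall fun n => one_mul _

theorem tendsto_mul_hypTerm {a b c d : ℝ} (ha : ∀ k : ℕ, a ≠ -k) (hb : ∀ k : ℕ, b ≠ -k)
    (h : 1 < c + d - a - b) : Tendsto (fun m : ℕ => m * hypTerm a b c d m) atTop (𝓝 0) := by
  rw [← tendsto_add_atTop_iff_nat 1]
  set s := c + d - a - b
  have h1 : Tendsto (fun m : ℕ => (m : ℝ) ^ (-(s - 1)) + (m : ℝ) ^ (-s)) atTop (𝓝 (0 + 0)) :=
    ((tendsto_rpow_neg_atTop (by linarith)).comp tendsto_natCast_atTop_atTop).add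
      ((tendsto_rpow_neg_atTop (by linarith)).comp tendsto_natCast_atTop_atTop)
  have h2 := (tendsto_hypTerm_mul_rpow ha hb c d).mul h1
  rw [add_zero, mul_zero] at h2
  refine h2.congr' ?_
  filter_upwards [eventually_gt_atTop 0] with n hn
  have hn' : (0 : ℝ) < n := by exact_mod_cast hn
  have h3 : (n : ℝ) ^ s ≠ 0 := by positivity
  rw [show -(s - 1) = -s + 1 by ring, Real.rpow_add_one hn'.ne', Real.rpow_neg hn'.le]
  change hypTerm a b c d (n + 1) * (n : ℝ) ^ s * _ = _
  push_cast
  field_simp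

/-- The contiguous relation behind Gauss's theorem. -/
theorem tsum_hypTerm_one_recurrence {a b c : ℝ} (ha : ∀ k : ℕ, a ≠ -k) (hb : ∀ k : ℕ, b ≠ -k)
    (hc : 0 < c) (h : 0 < c - a - b) :
    c * (c - a - b) * ∑' m, hypTerm a b c 1 m =
      (c - a) * (c - b) * ∑' m, hypTerm a b (c + 1) 1 m := by
  have s1 : Summable (hypTerm a b c 1) := summable_hypTerm ha hb (by linarith)
  have s2 : Summable (hypTerm a b (c + 1) 1) := summable_hypTerm ha hb (by linarith)
  -- Termwise the relation holds up to the telescoping difference of `c * m * hypTerm a b c 1 m`,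
  -- which vanishes at `m = 0` and at infinity.
  have key : ∀ m : ℕ, c * (c - a - b) * hypTerm a b c 1 m -
      (c - a) * (c - b) * hypTerm a b (c + 1) 1 m =
        c * (m * hypTerm a b c 1 m) - c * ((m + 1 : ℕ) * hypTerm a b c 1 (m + 1)) := by
    intro m
    have hcm : c + m ≠ 0 := by positivity
    have hm : (1 : ℝ) + m ≠ 0 := by positivity
    have e : hypTerm a b (c + 1) 1 m = hypTerm a b c 1 m * (c / (c + m)) := by
      have h1 := poch_add_one_mul c m
      have h2 := (poch_pos hc m).ne'
      have h3 := (poch_pos (show 0 < c + 1 by linarith) m).ne'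
      have h4 := (poch_pos one_pos m).ne'
      simp only [hypTerm]
      rw [div_mul_div_comm, div_eq_div_iff (by positivity) (by positivity)]
      linear_combination -(poch a m * poch b m * poch 1 m) * h1
    rw [hypTerm_succ, e]
    push_cast
    field_simp
    ring
  have t1 : Tendsto (fun M => ∑ m ∈ Finset.range M, (c * (c - a - b) * hypTerm a b c 1 m -
      (c - a) * (c - b) * hypTerm a b (c + 1) 1 m)) atTop (𝓝 0) := by
    have h0 := (tendsto_mul_hypTerm ha hb (c := c) (d := 1) (by linarith)).const_mul c
    have h1 := (tendsto_const_nhds (x := (0 : ℝ))).sub h0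
    rw [mul_zero, sub_zero] at h1
    refine h1.congr fun M => ?_
    rw [Finset.sum_congr rfl fun m _ => key m,
      Finset.sum_range_sub' fun m : ℕ => c * (m * hypTerm a b c 1 m)]
    simp
  have t2 := ((s1.mul_left (c * (c - a - b))).sub
    (s2.mul_left ((c - a) * (c - b)))).hasSum.tendsto_sum_nat
  have t3 := tendsto_nhds_unique t2 t1
  rw [(s1.mul_left _).tsum_sub (s2.mul_left _), tsum_mul_left, tsum_mul_left] at t3
  linarith

theorem tsum_hypTerm_one_iterate {a b c : ℝ} (ha : ∀ k : ℕ, a ≠ -k) (hb : ∀ k : ℕ, b ≠ -k)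
    (hc : 0 < c) (h : 0 < c - a - b) (K : ℕ) :
    ∑' m, hypTerm a b c 1 m =
      hypTerm (c - a) (c - b) c (c - a - b) K * ∑' m, hypTerm a b (c + K) 1 m := by
  induction K with
  | zero => simp [hypTerm_zero]
  | succ K ih =>
    have hK : (0 : ℝ) ≤ K := K.cast_nonneg
    have h1 := tsum_hypTerm_one_recurrence ha hb (c := c + K) (by linarith) (by linarith)
    rw [ih, hypTerm_succ, mul_assoc, Nat.cast_succ, ← add_assoc]
    congr 1
    have h2 : c + K ≠ 0 := by positivity
    have h3 : c - a - b + K ≠ 0 := by positivity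
    field_simp
    linear_combination h1

/-- As the lower parameter grows, every term but the one at `m = 0` dies. The series for `K = 0`
dominates, since `poch` is monotone in its base. -/
theorem tendsto_tsum_hypTerm_one {a b c : ℝ} (ha : ∀ k : ℕ, a ≠ -k) (hb : ∀ k : ℕ, b ≠ -k)
    (hc : 0 < c) (h : 0 < c - a - b) :
    Tendsto (fun K : ℕ => ∑' m, hypTerm a b (c + K) 1 m) atTop (𝓝 1) := by
  have hlim : ∑' m : ℕ, (if m = 0 then (1 : ℝ) else 0) = 1 := tsum_ite_eq 0 fun _ => (1 : ℝ)
  suffices H : Tendsto (fun K : ℕ => ∑' m, hypTerm a b (c + K) 1 m) atTop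
      (𝓝 (∑' m : ℕ, (if m = 0 then (1 : ℝ) else 0))) by rwa [hlim] at H
  refine tendsto_tsum_of_dominated_convergence
    (bound := fun m => ‖hypTerm a b c 1 m‖) ?_ ?_ ?_
  · exact (summable_hypTerm ha hb (by linarith)).norm
  · intro m
    rcases m with _ | m
    · simp [hypTerm_zero]
    · simp only [Nat.add_eq_zero_iff, one_ne_zero, and_false, if_false]
      have h1 : Tendsto (fun K : ℕ => c + (K : ℝ)) atTop atTop :=
        tendsto_atTop_add_const_left _ _ tendsto_natCast_atTop_atTop
      have h2 : Tendsto (fun K : ℕ => poch (c + K) (m + 1)) atTop atTop := by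
        refine tendsto_atTop_mono' _ ?_ h1
        filter_upwards [h1.eventually_ge_atTop 1] with K hK
        -- The factor of index `0` is `c + K`; all others are at least `1`.
        rw [poch, Finset.prod_range_succ', Nat.cast_zero, add_zero]
        refine le_mul_of_one_le_left (by linarith) (Finset.one_le_prod ?_)
        intro i _
        push_cast
        have : (0 : ℝ) ≤ i := i.cast_nonneg
        linarith
      have h3 := (h2.inv_tendsto_atTop).const_mul (poch a (m + 1) * poch b (m + 1) / poch 1 (m + 1))
      rw [mul_zero] at h3
      refine h3.congr fun K => ?_
      simp only [hypTerm, Pi.inv_apply]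
      rw [mul_comm (poch (c + K) (m + 1)), ← div_div, ← div_eq_mul_inv]
  · refine Eventually.of_forall fun K m => ?_
    have hK : (0 : ℝ) ≤ K := K.cast_nonneg
    have h1 := poch_pos hc m
    have h2 := poch_pos (show 0 < c + K by linarith) m
    have h4 := poch_pos one_pos m
    simp only [hypTerm, norm_div, norm_mul, Real.norm_of_nonneg h1.le, Real.norm_of_nonneg h2.le,
      Real.norm_of_nonneg h4.le]
    gcongr
    exact poch_mono hc (by linarith) m

/-- Gauss's summation theorem. -/
theorem tsum_hypTerm_one {a b c : ℝ} (ha : ∀ k : ℕ, a ≠ -k) (hb : ∀ k : ℕ, b ≠ -k)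
    (hca : ∀ k : ℕ, c - a ≠ -k) (hcb : ∀ k : ℕ, c - b ≠ -k) (hc : 0 < c) (h : 0 < c - a - b) :
    ∑' m, hypTerm a b c 1 m = Real.Gamma c * Real.Gamma (c - a - b) /
      (Real.Gamma (c - a) * Real.Gamma (c - b)) := by
  have h1 := tendsto_hypTerm_mul_rpow hca hcb c (c - a - b)
  -- The parameters of the iterated prefactor are balanced, so it converges to a quotient of Gamma
  -- values with no power of `K` left over.
  rw [show c + (c - a - b) - (c - a) - (c - b) = 0 by ring] at h1
  simp only [Real.rpow_zero, mul_one] at h1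
  have h2 := h1.mul ((tendsto_add_atTop_iff_nat 1).2 (tendsto_tsum_hypTerm_one ha hb hc h))
  rw [mul_one] at h2
  refine tendsto_nhds_unique (tendsto_const_nhds.congr fun K => ?_) h2
  exact tsum_hypTerm_one_iterate ha hb hc h (K + 1)

/-! ### The Wilf–Zeilberger acceleration -/

/-- The quotient of consecutive coefficients of the accelerated series. -/
noncomputable def accelRatio (a b c d : ℝ) (n : ℕ) : ℝ :=
  -((b + n) * (c + n - a) * (d + 2 * n - a) * (d + 2 * n - a + 1) * (d - b + n)) /
    ((c + n) * (d + 2 * n) * (d + 2 * n + 1) * (c + d - a - b - 1 + 2 * n) *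
      (c + d - a - b + 2 * n))

/-- The hypergeometric coefficient of the accelerated series. -/
noncomputable def accelCoeff (a b c d : ℝ) (n : ℕ) : ℝ :=
  ∏ i ∈ Finset.range n, accelRatio a b c d i

/-- The rational factor of the accelerated series. -/
noncomputable def accelFactor (a b c d : ℝ) (n : ℕ) : ℝ :=
  (c + n - 1) / (c + d - a - b - 1 + 2 * n) +
    (d + 2 * n - a) * (d - b + n) * (c + d - a + 3 * n) /
      ((d + 2 * n) * (c + d - a - b - 1 + 2 * n) * (c + d - a - b + 2 * n))

theorem accelCoeff_zero (a b c d : ℝ) : accelCoeff a b c d 0 = 1 := by simp [accelCoeff]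

theorem accelCoeff_succ (a b c d : ℝ) (n : ℕ) :
    accelCoeff a b c d (n + 1) = accelCoeff a b c d n * accelRatio a b c d n :=
  Finset.prod_range_succ _ _

/-- The family of series, indexed by `n`, joining a hypergeometric series to its acceleration. -/
noncomputable def accelTerm (a b c d : ℝ) (n m : ℕ) : ℝ :=
  accelCoeff a b c d n * hypTerm a (b + n) (c + n) (d + 2 * n) m

/-- The rational certificate of the Wilf–Zeilberger pair. -/
noncomputable def accelCert (a b c d : ℝ) (n m : ℕ) : ℝ :=
  (m + c + n - 1) / (c + d - a - b - 1 + 2 * n) +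
    (d + 2 * n - a) * (d - b + n) * (m + c + d - a + 3 * n) /
      ((d + 2 * n + m) * (c + d - a - b - 1 + 2 * n) * (c + d - a - b + 2 * n))

section

variable {a b c d : ℝ}

theorem hypTerm_add_one {b c d : ℝ} (hb : b ≠ 0) (hc : 0 < c) (hd : 0 < d) (a : ℝ) (m : ℕ) :
    hypTerm a (b + 1) (c + 1) (d + 1 + 1) m = hypTerm a b c d m *
      ((b + m) / b * (c / (c + m)) * (d / (d + m)) * ((d + 1) / (d + 1 + m))) := by
  have e1 := poch_add_one_mul b m
  have e2 := poch_add_one_mul c m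
  have e3 := poch_add_one_mul d m
  have e4 := poch_add_one_mul (d + 1) m
  rw [← eq_div_iff (by positivity)] at e1 e2 e3 e4
  have p1 : poch c m ≠ 0 := (poch_pos hc m).ne'
  have p2 : poch d m ≠ 0 := (poch_pos hd m).ne'
  simp only [hypTerm]
  rw [e4, e3, e2, e1]
  field_simp

/-- The factors `b + n`, `c + n`, `d + 2n` and `d + 2n + 1` of `accelRatio` cancel those produced by
raising the parameters of `hypTerm`. -/
theorem accelTerm_succ_left (hb : ∀ k : ℕ, b ≠ -k) (hc : 0 < c) (hd : 0 < d)
    (he : 0 < c + d - a - b - 1) (n m : ℕ) :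
    accelTerm a b c d (n + 1) m = accelTerm a b c d n m *
      (-((b + n + m) * (c + n - a) * (d + 2 * n - a) * (d + 2 * n - a + 1) * (d - b + n)) /
        ((c + n + m) * (d + 2 * n + m) * (d + 2 * n + 1 + m) * (c + d - a - b - 1 + 2 * n) *
          (c + d - a - b + 2 * n))) := by
  have hn : (0 : ℝ) ≤ n := n.cast_nonneg
  have hm : (0 : ℝ) ≤ m := m.cast_nonneg
  have hB : b + n ≠ 0 := by simpa using ne_neg_natCast_add hb n 0
  rw [accelTerm, accelCoeff_succ, accelRatio, Nat.cast_succ,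
    show b + ((n : ℝ) + 1) = b + n + 1 by ring, show c + ((n : ℝ) + 1) = c + n + 1 by ring,
    show d + 2 * ((n : ℝ) + 1) = d + 2 * n + 1 + 1 by ring,
    hypTerm_add_one hB (by positivity) (by positivity), accelTerm]
  generalize hypTerm a (b + n) (c + n) (d + 2 * n) m = t
  generalize accelCoeff a b c d n = k
  have h1 : c + d - a - b + 2 * n ≠ 0 := by linarith
  have h2 : c + d - a - b - 1 + 2 * n ≠ 0 := by linarith
  generalize c + d - a - b + 2 * (n : ℝ) = E' at *
  generalize c + d - a - b - 1 + 2 * (n : ℝ) = E at *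
  generalize (c + n - a) * (d + 2 * n - a) * (d + 2 * n - a + 1) * (d - b + n) = X
  have h3 : 0 < c + n := by positivity
  have h4 : 0 < d + 2 * n := by positivity
  generalize c + (n : ℝ) = C at *
  generalize d + 2 * (n : ℝ) = D at *
  generalize b + (n : ℝ) = B at *
  field_simp

theorem accelTerm_succ_right (n m : ℕ) :
    accelTerm a b c d n (m + 1) = accelTerm a b c d n m *
      ((a + m) * (b + n + m) / ((c + n + m) * (d + 2 * n + m))) := by
  rw [accelTerm, hypTerm_succ, ← mul_assoc]
  rfl

/-- The Wilf–Zeilberger equation divided by `F(n,m)`, with `x = m`, `C = c + n`, `D = d + 2n` and `E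
= c + d - a - b - 1 + 2n`. Then `b + n = C + D - a - 1 - E` and `d - b + n = a + 1 + E - C`, so `n`
disappears. -/
theorem accelCert_identity {x a C D E : ℝ} (h1 : C + x ≠ 0) (h2 : D + x ≠ 0)
    (h3 : D + 1 + x ≠ 0) (hE : E ≠ 0) (hE' : E + 1 ≠ 0) :
    1 + (C + D - a - 1 - E + x) * (C - a) * (D - a) * (D - a + 1) * (a + 1 + E - C) /
        ((C + x) * (D + x) * (D + 1 + x) * E * (E + 1)) =
      (x + C - 1) / E + (D - a) * (a + 1 + E - C) * (x + C + D - a) / ((D + x) * E * (E + 1)) -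
        (a + x) * (C + D - a - 1 - E + x) / ((C + x) * (D + x)) * ((x + C) / E +
          (D - a) * (a + 1 + E - C) * (x + 1 + C + D - a) / ((D + 1 + x) * E * (E + 1))) := by
  field_simp
  ring

theorem accelTerm_sub (hb : ∀ k : ℕ, b ≠ -k) (hc : 0 < c) (hd : 0 < d)
    (he : 0 < c + d - a - b - 1) (n m : ℕ) :
    accelTerm a b c d n m - accelTerm a b c d (n + 1) m =
      accelTerm a b c d n m * accelCert a b c d n m -
        accelTerm a b c d n (m + 1) * accelCert a b c d n (m + 1) := by
  rw [accelTerm_succ_left hb hc hd he, accelTerm_succ_right, accelCert, accelCert, Nat.cast_succ]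
  have hn : (0 : ℝ) ≤ n := n.cast_nonneg
  have hm : (0 : ℝ) ≤ m := m.cast_nonneg
  have key := accelCert_identity (x := m) (a := a) (C := c + n) (D := d + 2 * n)
    (E := c + d - a - b - 1 + 2 * n) (by positivity) (by positivity) (by positivity)
    (by linarith) (by linarith)
  linear_combination (exp := 1) accelTerm a b c d n m * key

theorem summable_accelTerm (ha : ∀ k : ℕ, a ≠ -k) (hb : ∀ k : ℕ, b ≠ -k)
    (he : 0 < c + d - a - b - 1) (n : ℕ) : Summable (accelTerm a b c d n) := by
  have hn : (0 : ℝ) ≤ n := n.cast_nonneg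
  exact (summable_hypTerm ha (ne_neg_natCast_add hb n) (by linarith)).mul_left _

/-- The certificate grows at most linearly in `m`, while `m * F(n,m)` tends to `0`. -/
theorem tendsto_accelTerm_mul_accelCert (ha : ∀ k : ℕ, a ≠ -k) (hb : ∀ k : ℕ, b ≠ -k)
    (he : 0 < c + d - a - b - 1) (n : ℕ) :
    Tendsto (fun m => accelTerm a b c d n m * accelCert a b c d n m) atTop (𝓝 0) := by
  have hn : (0 : ℝ) ≤ n := n.cast_nonneg
  have h0 : 1 < c + n + (d + 2 * n) - a - (b + n) := by linarith
  have t1 := (tendsto_mul_hypTerm ha (ne_neg_natCast_add hb n) h0).const_mul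
    (accelCoeff a b c d n)
  have t2 := (summable_accelTerm (c := c) (d := d) ha hb he n).tendsto_atTop_zero
  have t3 : Tendsto (fun m : ℕ => ((c + d - a + 3 * n) + 1 * (m : ℝ)) / ((d + 2 * n) + 1 * m))
      atTop (𝓝 (1 / 1)) := tendsto_add_mul_div_add_mul_atTop_nhds _ _ _ one_ne_zero
  have t4 := (t1.mul_const (1 / (c + d - a - b - 1 + 2 * n))).add
    ((t2.mul_const ((c + n - 1) / (c + d - a - b - 1 + 2 * n))).add
    ((t2.mul t3).mul_const ((d + 2 * n - a) * (d - b + n) /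
      ((c + d - a - b - 1 + 2 * n) * (c + d - a - b + 2 * n)))))
  simp only [mul_zero, zero_mul, add_zero] at t4
  refine t4.congr fun m => ?_
  rw [accelTerm, accelCert]
  simp only [div_eq_mul_inv, mul_inv, one_mul]
  generalize (c + d - a - b - 1 + 2 * (n : ℝ))⁻¹ = x
  generalize (c + d - a - b + 2 * (n : ℝ))⁻¹ = y
  generalize (d + 2 * (n : ℝ) + m)⁻¹ = z
  generalize hypTerm a (b + n) (c + n) (d + 2 * n) m = t
  ring

theorem tsum_accelTerm_sub (ha : ∀ k : ℕ, a ≠ -k) (hb : ∀ k : ℕ, b ≠ -k) (hc : 0 < c)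
    (hd : 0 < d) (he : 0 < c + d - a - b - 1) (n : ℕ) :
    ∑' m, accelTerm a b c d n m - ∑' m, accelTerm a b c d (n + 1) m =
      accelCoeff a b c d n * accelFactor a b c d n := by
  have s1 := summable_accelTerm (c := c) (d := d) ha hb he n
  have s2 := summable_accelTerm (c := c) (d := d) ha hb he (n + 1)
  rw [← s1.tsum_sub s2]
  refine tendsto_nhds_unique (s1.sub s2).hasSum.tendsto_sum_nat ?_
  have h := (tendsto_const_nhds (x := accelTerm a b c d n 0 * accelCert a b c d n 0)).sub
    (tendsto_accelTerm_mul_accelCert (c := c) (d := d) ha hb he n)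
  rw [sub_zero] at h
  have e : accelTerm a b c d n 0 * accelCert a b c d n 0 =
      accelCoeff a b c d n * accelFactor a b c d n := by
    simp [accelTerm, accelCert, accelFactor, hypTerm_zero]
  rw [e] at h
  refine h.congr fun M => ?_
  rw [Finset.sum_congr rfl fun m _ => accelTerm_sub hb hc hd he n m,
    Finset.sum_range_sub' fun m => accelTerm a b c d n m * accelCert a b c d n m, e]

/-- The ratio `F(n+1,m) / F(n,m)` has a bound independent of `m` that tends to `1/4` as `n` grows.
Uniformity in `m` is what lets whole rows be compared. -/
theorem eventually_abs_accelTerm_succ_le (hb : ∀ k : ℕ, b ≠ -k) (hc : 0 < c) (hd : 0 < d)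
    (he : 0 < c + d - a - b - 1) :
    ∀ᶠ n : ℕ in atTop, ∀ m, |accelTerm a b c d (n + 1) m| ≤ 1 / 2 * |accelTerm a b c d n m| := by
  have lim (x y u v : ℝ) (hv : v ≠ 0) : Tendsto (fun n : ℕ => (x + u * n) / (y + v * n))
      atTop (𝓝 (u / v)) := tendsto_add_mul_div_add_mul_atTop_nhds x y u hv
  set e := c + d - a - b - 1 with hedef
  have t0 : Tendsto (fun n : ℕ => 1 + |b - c| / (c + n)) atTop (𝓝 (1 + 0)) :=
    tendsto_const_nhds.add (tendsto_const_nhds.div_atTop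
      (tendsto_atTop_add_const_left _ _ tendsto_natCast_atTop_atTop))
  have t := t0.mul ((((lim (c - a) d 1 2 two_ne_zero).mul
    (lim (d - a) (d + 1) 2 2 two_ne_zero)).mul
    ((lim (d - a + 1) e 2 2 two_ne_zero).mul (lim (d - b) (e + 1) 1 2 two_ne_zero))).abs)
  norm_num only [abs_of_pos] at t
  filter_upwards [t.eventually_le_const (show (1 / 4 : ℝ) < 1 / 2 by norm_num)] with n hn m
  have hn0 : (0 : ℝ) ≤ n := n.cast_nonneg
  have hm0 : (0 : ℝ) ≤ m := m.cast_nonneg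
  rw [accelTerm_succ_left hb hc hd he, abs_mul, mul_comm]
  refine mul_le_mul_of_nonneg_right (le_trans ?_ hn) (abs_nonneg _)
  rw [← hedef, show c + d - a - b + 2 * (n : ℝ) = e + 1 + 2 * n by rw [hedef]; ring]
  -- This is the only numerator factor that depends on `m`; it is matched with `c + n + m`, and `m`
  -- is dropped from the remaining denominators.
  have h1 : |b + n + m| ≤ (1 + |b - c| / (c + n)) * (c + n + m) := by
    rw [show b + n + m = (b - c) + (c + n + m) by ring]
    refine (abs_add_le _ _).trans ?_
    rw [abs_of_pos (show 0 < c + n + m by positivity), one_add_mul, add_comm]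
    gcongr
    rw [div_mul_eq_mul_div, le_div_iff₀ (by positivity)]
    exact mul_le_mul_of_nonneg_left (by linarith) (abs_nonneg _)
  simp only [one_mul, ← neg_mul, abs_mul, abs_div, abs_neg,
    abs_of_pos (show 0 < c + n + m by positivity),
    abs_of_pos (show 0 < d + 2 * n + m by positivity),
    abs_of_pos (show 0 < d + 2 * n + 1 + m by positivity),
    abs_of_pos (show 0 < e + 2 * n by positivity),
    abs_of_pos (show 0 < e + 1 + 2 * n by positivity),
    abs_of_pos (show 0 < d + 2 * n by positivity),
    abs_of_pos (show 0 < d + 1 + 2 * n by positivity)]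
  rw [show c + n - a = c - a + n by ring, show d + 2 * n - a = d - a + 2 * n by ring,
    show d - a + 2 * n + 1 = d - a + 1 + 2 * n by ring]
  calc _ ≤ (1 + |b - c| / (c + n)) * (c + n + m) * |c - a + n| * |d - a + 2 * n| *
        |d - a + 1 + 2 * n| * |d - b + n| /
        ((c + n + m) * (d + 2 * n) * (d + 1 + 2 * n) * (e + 2 * n) * (e + 1 + 2 * n)) := by
        gcongr ?_ * _ * _ * _ * _ / (_ * ?_ * ?_ * _ * _)
        · linarith
        · linarith
    _ = _ := by field_simp

theorem tendsto_tsum_accelTerm (ha : ∀ k : ℕ, a ≠ -k) (hb : ∀ k : ℕ, b ≠ -k) (hc : 0 < c)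
    (hd : 0 < d) (he : 0 < c + d - a - b - 1) :
    Tendsto (fun n => ∑' m, accelTerm a b c d n m) atTop (𝓝 0) := by
  have hs (n : ℕ) := (summable_accelTerm (c := c) (d := d) ha hb he n).abs
  refine squeeze_zero_norm (a := fun n => ∑' m, |accelTerm a b c d n m|)
    (fun n => norm_tsum_le_tsum_norm (hs n)) ?_
  -- The absolute row sums pass the ratio test, so they form a summable sequence and tend to `0`.
  refine (summable_of_ratio_norm_eventually_le (r := 1 / 2) (by norm_num) ?_).tendsto_atTop_zero
  filter_upwards [eventually_abs_accelTerm_succ_le hb hc hd he] with n hn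
  rw [Real.norm_of_nonneg (tsum_nonneg fun _ => abs_nonneg _),
    Real.norm_of_nonneg (tsum_nonneg fun _ => abs_nonneg _), ← tsum_mul_left]
  exact (hs (n + 1)).tsum_le_tsum hn ((hs n).mul_left _)

/-- The accelerated series has the same sum as the hypergeometric series at argument `1`. -/
theorem tendsto_sum_accel (ha : ∀ k : ℕ, a ≠ -k) (hb : ∀ k : ℕ, b ≠ -k) (hc : 0 < c)
    (hd : 0 < d) (he : 0 < c + d - a - b - 1) :
    Tendsto (fun N => ∑ n ∈ Finset.range N, accelCoeff a b c d n * accelFactor a b c d n) atTop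
      (𝓝 (∑' m, hypTerm a b c d m)) := by
  have h := (tendsto_const_nhds (x := ∑' m, accelTerm a b c d 0 m)).sub
    (tendsto_tsum_accelTerm ha hb hc hd he)
  rw [sub_zero] at h
  have e : ∑' m, hypTerm a b c d m = ∑' m, accelTerm a b c d 0 m := by
    simp [accelTerm, accelCoeff_zero]
  rw [e]
  refine h.congr fun N => ?_
  rw [← Finset.sum_range_sub' fun n => ∑' m, accelTerm a b c d n m]
  exact Finset.sum_congr rfl fun n _ => tsum_accelTerm_sub ha hb hc hd he n

end

/-! ### From accelerated series to Ramanujan type formulas -/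

theorem pochQuot_zero (a b : Fin 3 → ℚ) : pochQuot a b 0 = 1 := by simp [pochQuot, poch_zero]

theorem pochQuot_succ (a b : Fin 3 → ℚ) (n : ℕ) :
    pochQuot a b (n + 1) = pochQuot a b n * ∏ i, ((a i + n) / (b i + n) : ℝ) := by
  simp only [pochQuot, poch_succ, Finset.prod_mul_distrib, Finset.prod_div_distrib]
  rw [div_mul_div_comm]

theorem ratCast_ne_neg_natCast {x : ℚ} (hx : ∀ k : ℕ, x ≠ -k) (k : ℕ) : (x : ℝ) ≠ -k := by
  exact_mod_cast hx k

theorem pochQuot_ne_zero {a b : Fin 3 → ℚ} (ha : ∀ i (k : ℕ), a i ≠ -k)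
    (hb : ∀ i (k : ℕ), b i ≠ -k) (n : ℕ) : pochQuot a b n ≠ 0 :=
  div_ne_zero (Finset.prod_ne_zero_iff.2 fun i _ => poch_ne_zero (ratCast_ne_neg_natCast (ha i)) n)
    (Finset.prod_ne_zero_iff.2 fun i _ => poch_ne_zero (ratCast_ne_neg_natCast (hb i)) n)

theorem tendsto_prod_add_div_add (a b : Fin 3 → ℚ) :
    Tendsto (fun n : ℕ => ∏ i, ((a i + n) / (b i + n) : ℝ)) atTop (𝓝 1) := by
  have h : Tendsto (fun n : ℕ => ∏ i, ((a i + n) / (b i + n) : ℝ)) atTop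
      (𝓝 (∏ _i : Fin 3, 1)) := by
    refine tendsto_finsetProd _ fun i _ => ?_
    simpa using tendsto_add_mul_div_add_mul_atTop_nhds (a i : ℝ) (b i) 1 one_ne_zero
  simpa using h

theorem tendsto_ramanujanTerm_ratio {z : ℚ} {a b : Fin 3 → ℚ} {c₁ c₂ : ℚ} (hz : z ≠ 0)
    (ha : ∀ i (k : ℕ), a i ≠ -k) (hb : ∀ i (k : ℕ), b i ≠ -k) (hc : c₁ ≠ 0) :
    Tendsto (fun n : ℕ => ramanujanTerm z a b c₁ c₂ (n + 1) / ramanujanTerm z a b c₁ c₂ n)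
      atTop (𝓝 (z : ℝ)) := by
  have hc' : (c₁ : ℝ) ≠ 0 := by exact_mod_cast hc
  have hz' : (z : ℝ) ≠ 0 := by exact_mod_cast hz
  have h := ((tendsto_const_nhds (x := (z : ℝ))).mul (tendsto_prod_add_div_add a b)).mul
    (tendsto_add_mul_div_add_mul_atTop_nhds ((c₁ : ℝ) + c₂) (c₂ : ℝ) (c₁ : ℝ) hc')
  rw [mul_one, div_self hc', mul_one] at h
  refine h.congr fun n => ?_
  have hq := pochQuot_ne_zero ha hb n
  simp only [ramanujanTerm, pochQuot_succ, pow_succ, Nat.cast_succ]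
  rw [show (c₁ : ℝ) * (n + 1) + c₂ = c₁ + c₂ + c₁ * n by ring,
    show (c₁ : ℝ) * n + c₂ = c₂ + c₁ * n by ring]
  have hzn : (z : ℝ) ^ n ≠ 0 := pow_ne_zero _ hz'
  generalize (∏ i, ((a i + n) / (b i + n) : ℝ)) = p
  rw [show (z : ℝ) ^ n * z * (pochQuot a b n * p) * (c₁ + c₂ + c₁ * n) =
    (z : ℝ) ^ n * pochQuot a b n * (z * p * (c₁ + c₂ + c₁ * n)) by ring,
    mul_div_mul_left _ _ (mul_ne_zero hzn hq), mul_div_assoc]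

theorem eventually_linear_ne_zero {c₁ : ℝ} (hc : c₁ ≠ 0) (c₂ : ℝ) :
    ∀ᶠ n : ℕ in atTop, c₁ * n + c₂ ≠ 0 := by
  filter_upwards [(tendsto_natCast_atTop_atTop (R := ℝ)).eventually_gt_atTop (-c₂ / c₁)]
    with n hn h
  refine hn.ne ?_
  field_simp
  linarith

theorem summable_ramanujanTerm {z : ℚ} {a b : Fin 3 → ℚ} {c₁ c₂ : ℚ} (hz : z ≠ 0)
    (hz1 : |z| < 1) (ha : ∀ i (k : ℕ), a i ≠ -k) (hb : ∀ i (k : ℕ), b i ≠ -k) (hc : c₁ ≠ 0) :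
    Summable (ramanujanTerm z a b c₁ c₂) := by
  have hz1' : |(z : ℝ)| < 1 := by exact_mod_cast hz1
  refine summable_of_ratio_test_tendsto_lt_one hz1' ?_ ?_
  · filter_upwards [eventually_linear_ne_zero (show (c₁ : ℝ) ≠ 0 by exact_mod_cast hc) c₂]
      with n hn
    exact mul_ne_zero (mul_ne_zero (pow_ne_zero _ (by exact_mod_cast hz))
      (pochQuot_ne_zero ha hb n)) hn
  · simpa only [abs_div, Real.norm_eq_abs] using
      (tendsto_ramanujanTerm_ratio (c₂ := c₂) hz ha hb hc).abs

/-- The ratio test already gives absolute convergence, so the limit of the partial sums identifies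
the sum. -/
theorem isRamanujanTypeFormula_of_tendsto {S : ℝ} {z : ℚ} {a b : Fin 3 → ℚ} {c₁ c₂ : ℚ}
    (hz : z ≠ 0) (hz1 : |z| < 1) (ha : ∀ i (k : ℕ), a i ≠ -k) (hb : ∀ i (k : ℕ), b i ≠ -k)
    (hab : ∀ (i k : Fin 3) (m : ℤ), a i - b k ≠ m) (hc : c₁ ≠ 0)
    (hS : Tendsto (fun N => ∑ n ∈ Finset.range N, ramanujanTerm z a b c₁ c₂ n) atTop (𝓝 S)) :
    IsRamanujanTypeFormula S z a b c₁ c₂ where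
  denom_ne_zero k n := poch_ne_zero (ratCast_ne_neg_natCast (hb k)) n
  irreducible := hab
  rate := tendsto_ramanujanTerm_ratio hz ha hb hc
  hasSum := by
    have h := (summable_ramanujanTerm (c₂ := c₂) hz hz1 ha hb hc).hasSum
    rwa [tendsto_nhds_unique h.tendsto_sum_nat hS] at h

/-- If `R n` is the quotient of two sequences with the displayed quotients of consecutive terms,
the coefficient of the accelerated series is `R n` times that of a Ramanujan type series. -/
theorem accelCoeff_eq_mul_pochQuot {z : ℚ} {a b : Fin 3 → ℚ} {α β γ δ : ℝ} {R : ℕ → ℝ}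
    (R0 : R 0 = 1)
    (hR : ∀ n : ℕ, R (n + 1) * (z * ∏ i, ((a i + n) / (b i + n) : ℝ)) =
      R n * accelRatio α β γ δ n) (n : ℕ) :
    accelCoeff α β γ δ n = z ^ n * pochQuot a b n * R n := by
  induction n with
  | zero => simp [accelCoeff_zero, pochQuot_zero, R0]
  | succ n ih =>
    rw [accelCoeff_succ, ih, mul_assoc, ← hR, pochQuot_succ, pow_succ]
    ring

theorem isRamanujanTypeFormula_of_accel {z : ℚ} {a b : Fin 3 → ℚ} {c₁ c₂ : ℚ}
    {α β γ δ lam : ℝ} {R : ℕ → ℝ} (hα : ∀ k : ℕ, α ≠ -k) (hβ : ∀ k : ℕ, β ≠ -k) (hγ : 0 < γ)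
    (hδ : 0 < δ) (he : 0 < γ + δ - α - β - 1)
    (hz : z ≠ 0) (hz1 : |z| < 1) (ha : ∀ i (k : ℕ), a i ≠ -k) (hb : ∀ i (k : ℕ), b i ≠ -k)
    (hab : ∀ (i k : Fin 3) (m : ℤ), a i - b k ≠ m) (hc : c₁ ≠ 0) (R0 : R 0 = 1)
    (hR : ∀ n : ℕ, R (n + 1) * (z * ∏ i, ((a i + n) / (b i + n) : ℝ)) =
      R n * accelRatio α β γ δ n)
    (hfac : ∀ n : ℕ, (c₁ : ℝ) * n + c₂ = lam * (R n * accelFactor α β γ δ n)) :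
    IsRamanujanTypeFormula (lam * ∑' m, hypTerm α β γ δ m) z a b c₁ c₂ := by
  refine isRamanujanTypeFormula_of_tendsto hz hz1 ha hb hab hc ?_
  refine ((tendsto_sum_accel hα hβ hγ hδ he).const_mul lam).congr fun N => ?_
  rw [Finset.mul_sum]
  refine Finset.sum_congr rfl fun n _ => ?_
  rw [accelCoeff_eq_mul_pochQuot R0 hR, ramanujanTerm, hfac]
  ring

theorem ne_neg_natCast_of_den_ne_one {x : ℚ} (hx : x.den ≠ 1) (k : ℕ) : x ≠ -k := by
  rintro rfl
  exact hx (by simp)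

theorem ne_intCast_of_den_ne_one {x : ℚ} (hx : x.den ≠ 1) (m : ℤ) : x ≠ m := by
  rintro rfl
  exact hx (by simp)

theorem sub_ne_intCast_of_den_ne_one {a b : Fin 3 → ℚ} (h : ∀ i k, (a i - b k).den ≠ 1)
    (i k : Fin 3) (m : ℤ) : a i - b k ≠ m :=
  ne_intCast_of_den_ne_one (h i k) m

/-- Replaces infinitely many inequalities by a decidable condition on each parameter. -/
theorem ne_neg_natCast_of_pos_or_den {a : Fin 3 → ℚ} (h : ∀ i, 0 < a i ∨ (a i).den ≠ 1)
    (i : Fin 3) (k : ℕ) : a i ≠ -k := by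
  rcases h i with h | h
  · have : (0 : ℚ) ≤ k := k.cast_nonneg
    intro h'
    linarith
  · exact ne_neg_natCast_of_den_ne_one h k

theorem real_ne_neg_natCast {x : ℝ} (q : ℚ) (hx : x = q) (h : 0 < q ∨ q.den ≠ 1) (k : ℕ) :
    x ≠ -k := by
  rw [hx]
  exact ratCast_ne_neg_natCast (ne_neg_natCast_of_pos_or_den (a := fun _ => q) (fun _ => h) 0) k

/-- The acceleration treats `c` and `d` differently, but Gauss's theorem is stated with `d = 1`;
this covers the formulas with `c = 1`. -/
theorem hypTerm_swap (a b c d : ℝ) : hypTerm a b c d = hypTerm a b d c := by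
  ext m
  rw [hypTerm, hypTerm, mul_comm (poch c m)]

/-! ### Special values of the Gamma function -/

theorem Gamma_one_fourth_mul_Gamma_three_fourths :
    Real.Gamma (1 / 4) * Real.Gamma (3 / 4) = √2 * Real.pi := by
  have h := Real.Gamma_mul_Gamma_one_sub (1 / 4)
  have h2 : √2 * √2 = 2 := Real.mul_self_sqrt (by norm_num)
  rw [show (1 : ℝ) - 1 / 4 = 3 / 4 by norm_num, mul_one_div, Real.sin_pi_div_four] at h
  rw [h]
  field_simp
  linarith

theorem Gamma_one_third_mul_Gamma_two_thirds :
    Real.Gamma (1 / 3) * Real.Gamma (2 / 3) = 2 / 3 * √3 * Real.pi := by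
  have h := Real.Gamma_mul_Gamma_one_sub (1 / 3)
  have h2 : √3 * √3 = 3 := Real.mul_self_sqrt (by norm_num)
  rw [show (1 : ℝ) - 1 / 3 = 2 / 3 by norm_num, mul_one_div, Real.sin_pi_div_three] at h
  rw [h]
  field_simp
  linarith

theorem Gamma_one_sixth_mul_Gamma_five_sixths :
    Real.Gamma (1 / 6) * Real.Gamma (5 / 6) = 2 * Real.pi := by
  have h := Real.Gamma_mul_Gamma_one_sub (1 / 6)
  rw [show (1 : ℝ) - 1 / 6 = 5 / 6 by norm_num, mul_one_div, Real.sin_pi_div_six] at h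
  rw [h]
  field_simp

/-- Legendre duplication at `1/3`; the source of the cube root of `2`. -/
theorem Gamma_one_third_mul_Gamma_five_sixths :
    Real.Gamma (1 / 3) * Real.Gamma (5 / 6) =
      Real.Gamma (2 / 3) * (2 : ℝ) ^ (1 / 3 : ℝ) * √Real.pi := by
  have h := Real.Gamma_mul_Gamma_add_half (1 / 3)
  norm_num at h ⊢
  exact h

theorem Gamma_three_halves : Real.Gamma (3 / 2) = 1 / 2 * √Real.pi := by
  rw [show (3 / 2 : ℝ) = 1 / 2 + 1 by norm_num, Real.Gamma_add_one (by norm_num),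
    Real.Gamma_one_half_eq]

theorem Gamma_five_fourths : Real.Gamma (5 / 4) = 1 / 4 * Real.Gamma (1 / 4) := by
  rw [show (5 / 4 : ℝ) = 1 / 4 + 1 by norm_num, Real.Gamma_add_one (by norm_num)]

theorem Gamma_seven_fourths : Real.Gamma (7 / 4) = 3 / 4 * Real.Gamma (3 / 4) := by
  rw [show (7 / 4 : ℝ) = 3 / 4 + 1 by norm_num, Real.Gamma_add_one (by norm_num)]

theorem Gamma_eleven_sixths : Real.Gamma (11 / 6) = 5 / 6 * Real.Gamma (5 / 6) := by
  rw [show (11 / 6 : ℝ) = 5 / 6 + 1 by norm_num, Real.Gamma_add_one (by norm_num)]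

theorem tsum_hypTerm_eq {a b c u v e : ℝ} (ha : ∀ k : ℕ, a ≠ -k) (hb : ∀ k : ℕ, b ≠ -k)
    (hu : 0 < u) (hv : 0 < v) (hc : 0 < c) (he : 0 < e) (hcu : c - a = u) (hcv : c - b = v)
    (hce : c - a - b = e) :
    ∑' m, hypTerm a b c 1 m =
      Real.Gamma c * Real.Gamma e / (Real.Gamma u * Real.Gamma v) := by
  subst hcu hcv hce
  exact tsum_hypTerm_one ha hb (ne_neg_natCast_of_pos hu) (ne_neg_natCast_of_pos hv) hc he

/-! ### Formulas evaluated directly by Gauss's theorem -/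

theorem isRamanujanTypeFormula_eight_sqrt_two :
    IsRamanujanTypeFormula (8 * √2) (-1 / 4)
      ![5 / 8, 3 / 4, 9 / 8] ![1 / 2, 1, 3 / 2] 40 19 := by
  have hα := real_ne_neg_natCast (x := -1 / 4) (-1 / 4) (by norm_num) (by decide +kernel)
  have hβ := real_ne_neg_natCast (x := 1 / 4) (1 / 4) (by norm_num) (by decide +kernel)
  have h := isRamanujanTypeFormula_of_accel (lam := 16) (c₁ := 40) (c₂ := 19) (z := -1 / 4)
    -- `R n = (3/2)_n / (1/2)_n`: the acceleration has `(1/2)_n` twice in the denominator, and one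
    -- copy is raised to `(3/2)_n`. The value of `lam` is fixed by `c₂ = lam * accelFactor 0`. The
    -- other formulas follow the same pattern.
    (R := fun n => 2 * ((n : ℝ) + 1 / 2))
    (a := ![5 / 8, 3 / 4, 9 / 8]) (b := ![1 / 2, 1, 3 / 2])
    hα hβ (γ := 1 / 2) (δ := 1) (by norm_num) (by norm_num) (by norm_num) (by norm_num)
    (by norm_num [abs_lt]) (ne_neg_natCast_of_pos_or_den (by decide +kernel))
    (ne_neg_natCast_of_pos_or_den (by decide +kernel))
    (sub_ne_intCast_of_den_ne_one (by decide +kernel)) (by norm_num) (by norm_num)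
    (fun n => by
      simp [Fin.prod_univ_three, accelRatio]
      norm_num only
      field_simp
      ring)
    (fun n => by
      simp [accelFactor]
      norm_num only
      field_simp
      ring)
  rw [tsum_hypTerm_eq hα hβ (u := 3 / 4) (v := 1 / 4) (e := 1 / 2) (by norm_num)
    (by norm_num) (by norm_num) (by norm_num) (by norm_num) (by norm_num) (by norm_num)] at h
  rw [Real.Gamma_one_half_eq, mul_comm (Real.Gamma (3 / 4)),
    Gamma_one_fourth_mul_Gamma_three_fourths, Real.mul_self_sqrt Real.pi_nonneg] at h
  convert h using 1
  have h2 : √2 * √2 = 2 := Real.mul_self_sqrt (by norm_num)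
  field_simp
  linarith

theorem isRamanujanTypeFormula_sixteen_sqrt_two :
    IsRamanujanTypeFormula (16 * √2) (-1 / 4)
      ![1 / 8, 5 / 8, 3 / 4] ![1, 3 / 2, 3 / 2] 40 23 := by
  have hα := real_ne_neg_natCast (x := 3 / 4) (3 / 4) (by norm_num) (by decide +kernel)
  have hβ := real_ne_neg_natCast (x := 1 / 4) (1 / 4) (by norm_num) (by decide +kernel)
  have h := isRamanujanTypeFormula_of_accel (lam := 16) (c₁ := 40) (c₂ := 23) (z := -1 / 4)
    (R := fun n => 2 * ((n : ℝ) + 1 / 2))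
    (a := ![1 / 8, 5 / 8, 3 / 4]) (b := ![1, 3 / 2, 3 / 2])
    hα hβ (γ := 3 / 2) (δ := 1) (by norm_num) (by norm_num) (by norm_num) (by norm_num)
    (by norm_num [abs_lt]) (ne_neg_natCast_of_pos_or_den (by decide +kernel))
    (ne_neg_natCast_of_pos_or_den (by decide +kernel))
    (sub_ne_intCast_of_den_ne_one (by decide +kernel)) (by norm_num) (by norm_num)
    (fun n => by
      simp [Fin.prod_univ_three, accelRatio]
      norm_num only
      field_simp
      ring)
    (fun n => by
      simp [accelFactor]
      norm_num only
      field_simp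
      ring)
  rw [tsum_hypTerm_eq hα hβ (u := 3 / 4) (v := 5 / 4) (e := 1 / 2) (by norm_num)
    (by norm_num) (by norm_num) (by norm_num) (by norm_num) (by norm_num) (by norm_num)] at h
  rw [Real.Gamma_one_half_eq, Gamma_three_halves, Gamma_five_fourths, mul_assoc,
    Real.mul_self_sqrt Real.pi_nonneg, mul_left_comm, mul_comm (Real.Gamma (3 / 4)),
    Gamma_one_fourth_mul_Gamma_three_fourths] at h
  convert h using 1
  have h2 : √2 * √2 = 2 := Real.mul_self_sqrt (by norm_num)
  field_simp
  linarith

theorem isRamanujanTypeFormula_eight_sqrt_two_div_five :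
    IsRamanujanTypeFormula (8 * √2 / 5) (-1 / 4)
      ![5 / 8, 3 / 4, 9 / 8] ![1, 5 / 4, 5 / 4] 8 3 := by
  have hα := real_ne_neg_natCast (x := 1 / 4) (1 / 4) (by norm_num) (by decide +kernel)
  have hβ := real_ne_neg_natCast (x := 3 / 4) (3 / 4) (by norm_num) (by decide +kernel)
  have h := isRamanujanTypeFormula_of_accel (lam := 8 / 5) (c₁ := 8) (c₂ := 3) (z := -1 / 4)
    (R := fun n => 4 * ((n : ℝ) + 1 / 4))
    (a := ![5 / 8, 3 / 4, 9 / 8]) (b := ![1, 5 / 4, 5 / 4])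
    hα hβ (γ := 1) (δ := 3 / 2) (by norm_num) (by norm_num) (by norm_num) (by norm_num)
    (by norm_num [abs_lt]) (ne_neg_natCast_of_pos_or_den (by decide +kernel))
    (ne_neg_natCast_of_pos_or_den (by decide +kernel))
    (sub_ne_intCast_of_den_ne_one (by decide +kernel)) (by norm_num) (by norm_num)
    (fun n => by
      simp [Fin.prod_univ_three, accelRatio]
      norm_num only
      field_simp
      ring)
    (fun n => by
      simp [accelFactor]
      norm_num only
      field_simp
      ring)
  rw [hypTerm_swap, tsum_hypTerm_eq hα hβ (u := 5 / 4) (v := 3 / 4) (e := 1 / 2) (by norm_num)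
    (by norm_num) (by norm_num) (by norm_num) (by norm_num) (by norm_num) (by norm_num)] at h
  rw [Real.Gamma_one_half_eq, Gamma_three_halves, Gamma_five_fourths, mul_assoc,
    Real.mul_self_sqrt Real.pi_nonneg, mul_assoc,
    Gamma_one_fourth_mul_Gamma_three_fourths] at h
  convert h using 1
  have h2 : √2 * √2 = 2 := Real.mul_self_sqrt (by norm_num)
  field_simp
  linarith

theorem isRamanujanTypeFormula_sqrt_two_div_seven :
    IsRamanujanTypeFormula (96 * √2 / 7) (-1 / 4)
      ![5 / 4, 11 / 8, 15 / 8] ![1, 7 / 4, 7 / 4] 40 33 := by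
  have hα := real_ne_neg_natCast (x := -1 / 4) (-1 / 4) (by norm_num) (by decide +kernel)
  have hβ := real_ne_neg_natCast (x := 5 / 4) (5 / 4) (by norm_num) (by decide +kernel)
  have h := isRamanujanTypeFormula_of_accel (lam := 24) (c₁ := 40) (c₂ := 33) (z := -1 / 4)
    (R := fun n => 4 / 3 * ((n : ℝ) + 3 / 4))
    (a := ![5 / 4, 11 / 8, 15 / 8]) (b := ![1, 7 / 4, 7 / 4])
    hα hβ (γ := 1) (δ := 5 / 2) (by norm_num) (by norm_num) (by norm_num) (by norm_num)
    (by norm_num [abs_lt]) (ne_neg_natCast_of_pos_or_den (by decide +kernel))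
    (ne_neg_natCast_of_pos_or_den (by decide +kernel))
    (sub_ne_intCast_of_den_ne_one (by decide +kernel)) (by norm_num) (by norm_num)
    (fun n => by
      simp [Fin.prod_univ_three, accelRatio]
      norm_num only
      field_simp
      ring)
    (fun n => by
      simp [accelFactor]
      norm_num only
      field_simp
      ring)
  rw [hypTerm_swap, tsum_hypTerm_eq hα hβ (u := 11 / 4) (v := 5 / 4) (e := 3 / 2) (by norm_num)
    (by norm_num) (by norm_num) (by norm_num) (by norm_num) (by norm_num) (by norm_num)] at h
  rw [show (5 / 2 : ℝ) = 3 / 2 + 1 by norm_num, show (11 / 4 : ℝ) = 7 / 4 + 1 by norm_num,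
    Real.Gamma_add_one (by norm_num), Real.Gamma_add_one (by norm_num), Gamma_three_halves,
    Gamma_five_fourths, Gamma_seven_fourths,
    show 3 / 2 * (1 / 2 * √Real.pi) * (1 / 2 * √Real.pi) = 3 / 8 * (√Real.pi * √Real.pi) by ring,
    show 7 / 4 * (3 / 4 * Real.Gamma (3 / 4)) * (1 / 4 * Real.Gamma (1 / 4)) =
      21 / 64 * (Real.Gamma (1 / 4) * Real.Gamma (3 / 4)) by ring,
    Gamma_one_fourth_mul_Gamma_three_fourths, Real.mul_self_sqrt Real.pi_nonneg] at h
  convert h using 1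
  have h2 : √2 * √2 = 2 := Real.mul_self_sqrt (by norm_num)
  field_simp
  linarith

theorem isRamanujanTypeFormula_sqrt_two_div_eighty_one :
    IsRamanujanTypeFormula (416 * √2 / 81) (-1 / 4)
      ![7 / 8, 5 / 4, 11 / 8] ![1, 17 / 12, 25 / 12] 8 9 := by
  have hα := real_ne_neg_natCast (x := 1 / 12) (1 / 12) (by norm_num) (by decide +kernel)
  have hβ := real_ne_neg_natCast (x := 7 / 12) (7 / 12) (by norm_num) (by decide +kernel)
  have h := isRamanujanTypeFormula_of_accel (lam := 104 / 15) (c₁ := 8) (c₂ := 9) (z := -1 / 4)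
    (R := fun n => 12 / 13 * ((n : ℝ) + 13 / 12))
    (a := ![7 / 8, 5 / 4, 11 / 8]) (b := ![1, 17 / 12, 25 / 12])
    hα hβ (γ := 1) (δ := 11 / 6) (by norm_num) (by norm_num) (by norm_num) (by norm_num)
    (by norm_num [abs_lt]) (ne_neg_natCast_of_pos_or_den (by decide +kernel))
    (ne_neg_natCast_of_pos_or_den (by decide +kernel))
    (sub_ne_intCast_of_den_ne_one (by decide +kernel)) (by norm_num) (by norm_num)
    (fun n => by
      simp [Fin.prod_univ_three, accelRatio]
      norm_num only
      field_simp
      ring)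
    (fun n => by
      simp [accelFactor]
      norm_num only
      field_simp
      ring)
  rw [hypTerm_swap, tsum_hypTerm_eq hα hβ (u := 7 / 4) (v := 5 / 4) (e := 7 / 6) (by norm_num)
    (by norm_num) (by norm_num) (by norm_num) (by norm_num) (by norm_num) (by norm_num)] at h
  rw [Gamma_eleven_sixths, show (7 / 6 : ℝ) = 1 / 6 + 1 by norm_num,
    Real.Gamma_add_one (by norm_num), Gamma_five_fourths, Gamma_seven_fourths,
    show 5 / 6 * Real.Gamma (5 / 6) * (1 / 6 * Real.Gamma (1 / 6)) =
      5 / 36 * (Real.Gamma (1 / 6) * Real.Gamma (5 / 6)) by ring,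
    show 3 / 4 * Real.Gamma (3 / 4) * (1 / 4 * Real.Gamma (1 / 4)) =
      3 / 16 * (Real.Gamma (1 / 4) * Real.Gamma (3 / 4)) by ring,
    Gamma_one_fourth_mul_Gamma_three_fourths, Gamma_one_sixth_mul_Gamma_five_sixths] at h
  convert h using 1
  have h2 : √2 * √2 = 2 := Real.mul_self_sqrt (by norm_num)
  field_simp
  linarith

theorem isRamanujanTypeFormula_sqrt_two_div_three :
    IsRamanujanTypeFormula (56 * √2 / 3) (-1 / 4)
      ![1 / 8, 5 / 8, 3 / 4] ![11 / 12, 1, 19 / 12] 40 27 := by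
  have hα := real_ne_neg_natCast (x := 7 / 12) (7 / 12) (by norm_num) (by decide +kernel)
  have hβ := real_ne_neg_natCast (x := 1 / 12) (1 / 12) (by norm_num) (by decide +kernel)
  have h := isRamanujanTypeFormula_of_accel (lam := 56 / 3) (c₁ := 40) (c₂ := 27) (z := -1 / 4)
    (R := fun n => 12 / 7 * ((n : ℝ) + 7 / 12))
    (a := ![1 / 8, 5 / 8, 3 / 4]) (b := ![11 / 12, 1, 19 / 12])
    hα hβ (γ := 1) (δ := 5 / 6) (by norm_num) (by norm_num) (by norm_num) (by norm_num)
    (by norm_num [abs_lt]) (ne_neg_natCast_of_pos_or_den (by decide +kernel))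
    (ne_neg_natCast_of_pos_or_den (by decide +kernel))
    (sub_ne_intCast_of_den_ne_one (by decide +kernel)) (by norm_num) (by norm_num)
    (fun n => by
      simp [Fin.prod_univ_three, accelRatio]
      norm_num only
      field_simp
      ring)
    (fun n => by
      simp [accelFactor]
      norm_num only
      field_simp
      ring)
  rw [hypTerm_swap, tsum_hypTerm_eq hα hβ (u := 1 / 4) (v := 3 / 4) (e := 1 / 6) (by norm_num)
    (by norm_num) (by norm_num) (by norm_num) (by norm_num) (by norm_num) (by norm_num)] at h
  rw [mul_comm (Real.Gamma (5 / 6)), Gamma_one_sixth_mul_Gamma_five_sixths,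
    Gamma_one_fourth_mul_Gamma_three_fourths] at h
  convert h using 1
  have h2 : √2 * √2 = 2 := Real.mul_self_sqrt (by norm_num)
  field_simp
  linarith

theorem isRamanujanTypeFormula_sqrt_three_div_nine :
    IsRamanujanTypeFormula (256 * √3 / 9) (-1 / 4)
      ![-1 / 12, 5 / 12, 5 / 6] ![1, 5 / 3, 5 / 3] 60 49 := by
  have hα := real_ne_neg_natCast (x := 7 / 6) (7 / 6) (by norm_num) (by decide +kernel)
  have hβ := real_ne_neg_natCast (x := 1 / 6) (1 / 6) (by norm_num) (by decide +kernel)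
  have h := isRamanujanTypeFormula_of_accel (lam := 32) (c₁ := 60) (c₂ := 49) (z := -1 / 4)
    (R := fun n => 3 / 2 * ((n : ℝ) + 2 / 3))
    (a := ![-1 / 12, 5 / 12, 5 / 6]) (b := ![1, 5 / 3, 5 / 3])
    hα hβ (γ := 5 / 3) (δ := 1) (by norm_num) (by norm_num) (by norm_num) (by norm_num)
    (by norm_num [abs_lt]) (ne_neg_natCast_of_pos_or_den (by decide +kernel))
    (ne_neg_natCast_of_pos_or_den (by decide +kernel))
    (sub_ne_intCast_of_den_ne_one (by decide +kernel)) (by norm_num) (by norm_num)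
    (fun n => by
      simp [Fin.prod_univ_three, accelRatio]
      norm_num only
      field_simp
      ring)
    (fun n => by
      simp [accelFactor]
      norm_num only
      field_simp
      ring)
  rw [tsum_hypTerm_eq hα hβ (u := 1 / 2) (v := 3 / 2) (e := 1 / 3) (by norm_num)
    (by norm_num) (by norm_num) (by norm_num) (by norm_num) (by norm_num) (by norm_num)] at h
  rw [show (5 / 3 : ℝ) = 2 / 3 + 1 by norm_num, Real.Gamma_add_one (by norm_num),
    Gamma_three_halves, Real.Gamma_one_half_eq, mul_assoc, mul_comm (Real.Gamma (2 / 3)),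
    Gamma_one_third_mul_Gamma_two_thirds, mul_left_comm (√Real.pi),
    Real.mul_self_sqrt Real.pi_nonneg] at h
  convert h using 1
  have h2 : √3 * √3 = 3 := Real.mul_self_sqrt (by norm_num)
  field_simp
  linarith

theorem isRamanujanTypeFormula_cbrt_two_div_nine :
    IsRamanujanTypeFormula (44 * (2 : ℝ) ^ (1 / 3 : ℝ) / 9) (-1 / 4)
      ![2 / 3, 3 / 4, 5 / 4] ![5 / 12, 1, 23 / 12] 10 9 := by
  have hα := real_ne_neg_natCast (x := 1 / 3) (1 / 3) (by norm_num) (by decide +kernel)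
  have hβ := real_ne_neg_natCast (x := 7 / 6) (7 / 6) (by norm_num) (by decide +kernel)
  have h := isRamanujanTypeFormula_of_accel (lam := 44 / 15) (c₁ := 10) (c₂ := 9) (z := -1 / 4)
    -- Three shifts at once: `1/6` to `7/6` (cancelling a numerator), `11/12` to `23/12`, and
    -- `17/12` down to `5/12`.
    (R := fun n => 30 / 11 * ((n : ℝ) + 1 / 6) * (n + 11 / 12) / (n + 5 / 12))
    (a := ![2 / 3, 3 / 4, 5 / 4]) (b := ![5 / 12, 1, 23 / 12])
    hα hβ (γ := 1) (δ := 11 / 6) (by norm_num) (by norm_num) (by norm_num) (by norm_num)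
    (by norm_num [abs_lt]) (ne_neg_natCast_of_pos_or_den (by decide +kernel))
    (ne_neg_natCast_of_pos_or_den (by decide +kernel))
    (sub_ne_intCast_of_den_ne_one (by decide +kernel)) (by norm_num) (by norm_num)
    (fun n => by
      simp [Fin.prod_univ_three, accelRatio]
      norm_num only
      field_simp
      ring)
    (fun n => by
      simp [accelFactor]
      norm_num only
      field_simp
      ring)
  rw [hypTerm_swap, tsum_hypTerm_eq hα hβ (u := 3 / 2) (v := 2 / 3) (e := 1 / 3) (by norm_num)
    (by norm_num) (by norm_num) (by norm_num) (by norm_num) (by norm_num) (by norm_num)] at h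
  rw [Gamma_eleven_sixths, Gamma_three_halves, mul_assoc, mul_comm (Real.Gamma (5 / 6)),
    Gamma_one_third_mul_Gamma_five_sixths] at h
  convert h using 1
  have h2 := (Real.Gamma_pos_of_pos (show (0 : ℝ) < 2 / 3 by norm_num)).ne'
  field_simp
  norm_num

theorem isRamanujanTypeFormula_cbrt_two_div_three :
    IsRamanujanTypeFormula (20 * (2 : ℝ) ^ (1 / 3 : ℝ) / 3) (-1 / 4)
      ![1 / 4, 2 / 3, 3 / 4] ![11 / 12, 1, 17 / 12] 20 9 := by
  have hα := real_ne_neg_natCast (x := 1 / 3) (1 / 3) (by norm_num) (by decide +kernel)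
  have hβ := real_ne_neg_natCast (x := 1 / 6) (1 / 6) (by norm_num) (by decide +kernel)
  have h := isRamanujanTypeFormula_of_accel (lam := 20 / 3) (c₁ := 20) (c₂ := 9) (z := -1 / 4)
    (R := fun n => 12 / 5 * ((n : ℝ) + 5 / 12))
    (a := ![1 / 4, 2 / 3, 3 / 4]) (b := ![11 / 12, 1, 17 / 12])
    hα hβ (γ := 1) (δ := 5 / 6) (by norm_num) (by norm_num) (by norm_num) (by norm_num)
    (by norm_num [abs_lt]) (ne_neg_natCast_of_pos_or_den (by decide +kernel))
    (ne_neg_natCast_of_pos_or_den (by decide +kernel))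
    (sub_ne_intCast_of_den_ne_one (by decide +kernel)) (by norm_num) (by norm_num)
    (fun n => by
      simp [Fin.prod_univ_three, accelRatio]
      norm_num only
      field_simp
      ring)
    (fun n => by
      simp [accelFactor]
      norm_num only
      field_simp
      ring)
  rw [hypTerm_swap, tsum_hypTerm_eq hα hβ (u := 1 / 2) (v := 2 / 3) (e := 1 / 3) (by norm_num)
    (by norm_num) (by norm_num) (by norm_num) (by norm_num) (by norm_num) (by norm_num)] at h
  rw [Real.Gamma_one_half_eq, mul_comm (Real.Gamma (5 / 6)),
    Gamma_one_third_mul_Gamma_five_sixths] at h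
  convert h using 1
  have h2 := (Real.Gamma_pos_of_pos (show (0 : ℝ) < 2 / 3 by norm_num)).ne'
  field_simp

/-! ### The formula for log 2 -/

theorem hypTerm_half_one (m : ℕ) :
    hypTerm (1 / 2) 1 (3 / 2) 2 m = 1 / ((2 * m + 1) * (m + 1)) := by
  have h1 := poch_add_one_mul (1 / 2) m
  have h2 := poch_add_one_mul 1 m
  norm_num only at h1 h2
  have p1 := (poch_pos (show (0 : ℝ) < 3 / 2 by norm_num) m).ne'
  have p2 := (poch_pos (show (0 : ℝ) < 2 by norm_num) m).ne'
  rw [hypTerm, div_eq_div_iff (by positivity) (by positivity)]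
  linear_combination -poch 1 m * (2 * (m + 1)) * h1 - poch (3 / 2) m * h2

theorem sum_hypTerm_half_one (M : ℕ) :
    ∑ m ∈ Finset.range M, hypTerm (1 / 2) 1 (3 / 2) 2 m =
      2 * ((harmonic (2 * M) : ℝ) - harmonic M) := by
  induction M with
  | zero => simp
  | succ M ih =>
    rw [Finset.sum_range_succ, ih, hypTerm_half_one, show 2 * (M + 1) = 2 * M + 1 + 1 by ring,
      harmonic_succ, harmonic_succ, harmonic_succ]
    push_cast
    field_simp
    ring

theorem tsum_hypTerm_half_one : ∑' m, hypTerm (1 / 2) 1 (3 / 2) 2 m = 2 * Real.log 2 := by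
  have hs : Summable (hypTerm (1 / 2) 1 (3 / 2) 2) := summable_hypTerm
    (ne_neg_natCast_of_pos (by norm_num)) (ne_neg_natCast_of_pos one_pos) (by norm_num)
  refine tendsto_nhds_unique hs.hasSum.tendsto_sum_nat ?_
  have h1 := Real.tendsto_harmonic_sub_log
  -- Comparing the harmonic asymptotics at `2 * M` and `M` cancels Euler's constant and leaves `log
  -- 2`.
  have h2 := h1.comp (tendsto_id.const_mul_atTop' (r := 2) two_pos)
  have h3 := ((h2.sub h1).add_const (Real.log 2)).const_mul 2
  rw [sub_self, zero_add] at h3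
  refine h3.congr' ?_
  filter_upwards [eventually_gt_atTop 0] with M hM
  have hM' : (M : ℝ) ≠ 0 := by positivity
  rw [sum_hypTerm_half_one]
  simp only [Function.comp_apply, id]
  push_cast
  rw [Real.log_mul two_ne_zero hM']
  ring

theorem isRamanujanTypeFormula_sixteen_log_two :
    IsRamanujanTypeFormula (16 * Real.log 2) (-1 / 4)
      ![3 / 4, 1, 5 / 4] ![3 / 2, 3 / 2, 3 / 2] 20 13 := by
  have hα := real_ne_neg_natCast (x := 1 / 2) (1 / 2) (by norm_num) (by decide +kernel)
  have hβ := real_ne_neg_natCast (x := 1) 1 (by norm_num) (by decide +kernel)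
  have h := isRamanujanTypeFormula_of_accel (lam := 8) (c₁ := 20) (c₂ := 13) (z := -1 / 4)
    (R := fun n => 2 * ((n : ℝ) + 1 / 2))
    (a := ![3 / 4, 1, 5 / 4]) (b := ![3 / 2, 3 / 2, 3 / 2])
    hα hβ (γ := 3 / 2) (δ := 2) (by norm_num) (by norm_num) (by norm_num) (by norm_num)
    (by norm_num [abs_lt]) (ne_neg_natCast_of_pos_or_den (by decide +kernel))
    (ne_neg_natCast_of_pos_or_den (by decide +kernel))
    (sub_ne_intCast_of_den_ne_one (by decide +kernel)) (by norm_num) (by norm_num)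
    (fun n => by
      simp [Fin.prod_univ_three, accelRatio]
      norm_num only
      field_simp
      ring)
    (fun n => by
      simp [accelFactor]
      norm_num only
      field_simp
      ring)
  rw [tsum_hypTerm_half_one] at h
  convert h using 1
  ring

/-! ### The formula for -√3/2, with a telescoping correction -/

theorem isRamanujanTypeFormula_neg_sqrt_three_div_two :
    IsRamanujanTypeFormula (-√3 / 2) (-1 / 4)
      ![1 / 12, 1 / 6, 7 / 12] ![-2 / 3, 1 / 3, 1] 60 (-1) := by
  have hα := real_ne_neg_natCast (x := -1 / 6) (-1 / 6) (by norm_num) (by decide +kernel)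
  have ha := ne_neg_natCast_of_pos_or_den (a := ![1 / 12, 1 / 6, 7 / 12]) (by decide +kernel)
  have hb := ne_neg_natCast_of_pos_or_den (a := ![-2 / 3, 1 / 3, 1]) (by decide +kernel)
  have hn1 (n : ℕ) : 3 * (n : ℝ) - 2 ≠ 0 := by
    intro h
    have : 3 * n = 2 := by exact_mod_cast sub_eq_zero.1 h
    omega
  have hn2 (n : ℕ) : 6 * (n : ℝ) - 1 ≠ 0 := by
    intro h
    have : 6 * n = 1 := by exact_mod_cast sub_eq_zero.1 h
    omega
  have hcoeff := accelCoeff_eq_mul_pochQuot (z := -1 / 4) (a := ![1 / 12, 1 / 6, 7 / 12])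
    (b := ![-2 / 3, 1 / 3, 1]) (α := -1 / 6) (β := -1 / 6) (γ := 1 / 3) (δ := 1)
    -- Four integer shifts: `1/6` to `7/6`, `1/12` to `13/12`, `-2/3` to `1/3`, and `-1/6` to `5/6`.
    (R := fun n => 2 * (6 * (n : ℝ) + 1) * (12 * n + 1) / ((3 * n - 2) * (6 * n - 1)))
    (by norm_num)
    (fun n => by
      have h1 := hn1 n
      have h2 := hn2 n
      simp [Fin.prod_univ_three, accelRatio]
      norm_num only
      rw [show -(2 / 3) + (n : ℝ) = (3 * n - 2) / 3 by ring,
        show 3 * ((n : ℝ) + 1) - 2 = 3 * n + 1 by ring,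
        show 6 * ((n : ℝ) + 1) - 1 = 6 * n + 5 by ring]
      field_simp
      ring)
  -- Here `R n * accelFactor n` is not linear in `n`; the discrepancy is the difference `H (n + 1) -
  -- H n`. The factor `6 * n` gives `H 0 = 0`, and writing the rest as a `ramanujanTerm` times a
  -- convergent factor gives `H n → 0`, so the sum is unaffected.
  set H : ℕ → ℝ := fun n =>
    ramanujanTerm (-1 / 4) ![1 / 12, 1 / 6, 7 / 12] ![-2 / 3, 1 / 3, 1] (-48) 14 n *
      (6 * n / (6 * n - 1)) with hH
  have hHlim : Tendsto H atTop (𝓝 0) := by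
    have h1 := (summable_ramanujanTerm (z := -1 / 4) (c₁ := -48) (c₂ := 14) (by norm_num)
      (by norm_num [abs_lt]) ha hb (by norm_num)).tendsto_atTop_zero
    have h2 := tendsto_add_mul_div_add_mul_atTop_nhds (0 : ℝ) (-1) 6 (d := 6) (by norm_num)
    have h3 := h1.mul h2
    rw [zero_mul] at h3
    refine h3.congr fun n => ?_
    rw [hH, zero_add, neg_add_eq_sub]
  have hterm (n : ℕ) :
      ramanujanTerm (-1 / 4) ![1 / 12, 1 / 6, 7 / 12] ![-2 / 3, 1 / 3, 1] 60 (-1) n =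
        -3 / 4 * (accelCoeff (-1 / 6) (-1 / 6) (1 / 3) 1 n *
          accelFactor (-1 / 6) (-1 / 6) (1 / 3) 1 n) + (H (n + 1) - H n) := by
    have h1 := hn1 n
    have h2 := hn2 n
    rw [hcoeff, hH]
    simp only [ramanujanTerm, pochQuot_succ, pow_succ]
    generalize ((-1 / 4 : ℚ) : ℝ) ^ n = x
    generalize pochQuot ![1 / 12, 1 / 6, 7 / 12] ![-2 / 3, 1 / 3, 1] n = y
    simp [Fin.prod_univ_three, accelFactor]
    norm_num only
    rw [show -(2 / 3) + (n : ℝ) = (3 * n - 2) / 3 by ring,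
      show 6 * ((n : ℝ) + 1) - 1 = 6 * n + 5 by ring]
    generalize hu : 3 * (n : ℝ) - 2 = u at *
    generalize hv : 6 * (n : ℝ) - 1 = v at *
    field_simp
    rw [← hu, ← hv]
    ring
  refine isRamanujanTypeFormula_of_tendsto (by norm_num) (by norm_num [abs_lt]) ha hb
    (sub_ne_intCast_of_den_ne_one (by decide +kernel)) (by norm_num) ?_
  have h := ((tendsto_sum_accel hα hα (c := 1 / 3) (d := 1) (by norm_num) (by norm_num)
    (by norm_num)).const_mul (-3 / 4)).add hHlim
  rw [tsum_hypTerm_eq hα hα (u := 1 / 2) (v := 1 / 2) (e := 2 / 3) (by norm_num) (by norm_num)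
    (by norm_num) (by norm_num) (by norm_num) (by norm_num) (by norm_num), Real.Gamma_one_half_eq,
    Gamma_one_third_mul_Gamma_two_thirds, Real.mul_self_sqrt Real.pi_nonneg, add_zero] at h
  convert h using 1
  · ext N
    rw [Finset.sum_congr rfl fun n _ => hterm n, Finset.sum_add_distrib, ← Finset.mul_sum,
      Finset.sum_range_sub]
    simp [hH]
  · congr 1
    field_simp
    norm_num

theorem mainTheorem6 :
    IsRamanujanTypeFormula (8 * √2) (-1 / 4)
      ![5 / 8, 3 / 4, 9 / 8] ![1 / 2, 1, 3 / 2] 40 19 ∧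
    IsRamanujanTypeFormula (16 * √2) (-1 / 4)
      ![1 / 8, 5 / 8, 3 / 4] ![1, 3 / 2, 3 / 2] 40 23 ∧
    IsRamanujanTypeFormula (8 * √2 / 5) (-1 / 4)
      ![5 / 8, 3 / 4, 9 / 8] ![1, 5 / 4, 5 / 4] 8 3 ∧
    IsRamanujanTypeFormula (96 * √2 / 7) (-1 / 4)
      ![5 / 4, 11 / 8, 15 / 8] ![1, 7 / 4, 7 / 4] 40 33 ∧
    IsRamanujanTypeFormula (416 * √2 / 81) (-1 / 4)
      ![7 / 8, 5 / 4, 11 / 8] ![1, 17 / 12, 25 / 12] 8 9 ∧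
    IsRamanujanTypeFormula (56 * √2 / 3) (-1 / 4)
      ![1 / 8, 5 / 8, 3 / 4] ![11 / 12, 1, 19 / 12] 40 27 ∧
    IsRamanujanTypeFormula (256 * √3 / 9) (-1 / 4)
      ![-1 / 12, 5 / 12, 5 / 6] ![1, 5 / 3, 5 / 3] 60 49 ∧
    IsRamanujanTypeFormula (-√3 / 2) (-1 / 4)
      ![1 / 12, 1 / 6, 7 / 12] ![-2 / 3, 1 / 3, 1] 60 (-1) ∧
    IsRamanujanTypeFormula (16 * Real.log 2) (-1 / 4)
      ![3 / 4, 1, 5 / 4] ![3 / 2, 3 / 2, 3 / 2] 20 13 ∧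
    IsRamanujanTypeFormula (44 * (2 : ℝ) ^ (1 / 3 : ℝ) / 9) (-1 / 4)
      ![2 / 3, 3 / 4, 5 / 4] ![5 / 12, 1, 23 / 12] 10 9 ∧
    IsRamanujanTypeFormula (20 * (2 : ℝ) ^ (1 / 3 : ℝ) / 3) (-1 / 4)
      ![1 / 4, 2 / 3, 3 / 4] ![11 / 12, 1, 17 / 12] 20 9 :=
  ⟨isRamanujanTypeFormula_eight_sqrt_two, isRamanujanTypeFormula_sixteen_sqrt_two,
    isRamanujanTypeFormula_eight_sqrt_two_div_five, isRamanujanTypeFormula_sqrt_two_div_seven,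
    isRamanujanTypeFormula_sqrt_two_div_eighty_one, isRamanujanTypeFormula_sqrt_two_div_three,
    isRamanujanTypeFormula_sqrt_three_div_nine, isRamanujanTypeFormula_neg_sqrt_three_div_two,
    isRamanujanTypeFormula_sixteen_log_two, isRamanujanTypeFormula_cbrt_two_div_nine,
    isRamanujanTypeFormula_cbrt_two_div_three⟩
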